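/- Let $M_2$ be the algebra of complex $2\times 2$ matrices. A linear map $S: M_2\to M_2$ is called bistochastic if it is positive (it maps positive-semidefinite matrices to positive-semidefinite matrices), $S(\mathbf 1)=\mathbf 1$, and $\operatorname{Tr} S(X)=\operatorname{Tr} X$ for all $X\in M_2$. It is completely positive if $I_k\otimes S$ is positive on $M_k\otimes M_2$ for every $k\in\mathbb N$, and completely copositive if $S\circ t$ is completely positive, where $t(A)=A^{t}$ is the transposition. Let $\sigma_0=\frac1{\sqrt2}\mathbf 1$, let $$\sigma_1=\tfrac1{\sqrt2}\begin{pmatrix}0&1\\1&0\end{pmatrix},\quad \sigma_2=\tfrac1{\sqrt2}\begin{pmatrix}0&-i\\i&0\end{pmatrix},\quad \sigma_3=\tfrac1{\sqrt2}\begin{pmatrix}1&0\\0&-1\end{pmatrix},$$ and put $\sigma(x)=\sum_{\mu=0}^3x_\mu\sigma_\mu$ for $x\in\mathbb R^4$. For a linear map $S$ with $S(X^*)=S(X)^*$ for all $X$ (in particular for every positive $S$), let $\pi(S)\in M_4(\mathbb R)$ be the unique matrix such that $\sigma(\pi(S)x)=S(\sigma(x))$ for all $x\in\mathbb R^4$.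 Let $\Delta_\infty$ be the set of bistochastic maps of $M_2$, and $\Delta_1\subset\Delta_\infty$ the set of those that are both completely positive and completely copositive. Let $K_\infty=\{Y\in M_3(\mathbb R): \|Y\|\le 1\}$, where $\|\cdot\|$ is the operator norm with respect to the Euclidean norm of $\mathbb R^3$, and $K_1=\{Y\in M_3(\mathbb R): \|Y\|_1\le 1\}$, where $\|Y\|_1=t_1+t_2+t_3$ is the sum of the singular values of $Y$ (the trace norm). Theorem. The map $F$ that sends $S\in\Delta_\infty$ to the block $(\pi(S)_{ij})_{i,j=1,2,3}$ of $\pi(S)$ is a homeomorphism of $\Delta_\infty$ onto $K_\infty$ (for the topologies induced by the norms). The set $\Delta_\infty$ is convex and $F$ is affine: $F(\lambda S+(1-\lambda)T)=\lambda F(S)+(1-\lambda)F(T)$ for all $S,T\in\Delta_\infty$ and $0\le\lambda\le1$. Moreover, $F(\Delta_1)=K_1$. -/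

import Mathlib

open Matrix
open scoped ComplexOrder Kronecker

namespace QubitMaps

/-- `M n` is the algebra of complex matrices with rows and columns indexed by `n`. -/
abbrev M (n : Type) : Type := Matrix n n ℂ

/-- A linear map between matrix algebras is positive if it sends positive-semidefinite matrices to
positive-semidefinite matrices. -/
def IsPositive {m n : Type} (S : M m →ₗ[ℂ] M n) : Prop :=
  ∀ A : M m, A.PosSemidef → (S A).PosSemidef

/-- A linear map is Hermitian if `S (X*) = (S X)*`. -/
def IsHermitianMap {m n : Type} (S : M m →ₗ[ℂ] M n) : Prop :=
  ∀ X : M m, S Xᴴ = (S X)ᴴ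

/-- The map `I_k ⊗ S` on `M_k ⊗ M_n`, where the tensor product is identified with the matrices
indexed by `Fin k × n`, that is, with the `k × k` block matrices with blocks in `M_n`:
`S` is applied to every block. -/
def ampliation {n : Type} (k : ℕ) (S : M n →ₗ[ℂ] M n) : M (Fin k × n) →ₗ[ℂ] M (Fin k × n) where
  toFun A := Matrix.of fun p q => S (Matrix.of fun c d => A (p.1, c) (q.1, d)) p.2 q.2
  map_add' A B := by
    ext p q
    have h : (Matrix.of fun c d => (A + B) (p.1, c) (q.1, d) : M n) =
        Matrix.of (fun c d => A (p.1, c) (q.1, d)) + Matrix.of fun c d => B (p.1, c) (q.1, d) := by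
      ext; simp
    exact (congrArg (fun X => S X p.2 q.2) h).trans (by rw [map_add]; rfl)
  map_smul' z A := by
    ext p q
    have h : (Matrix.of fun c d => (z • A) (p.1, c) (q.1, d) : M n) =
        z • Matrix.of (fun c d => A (p.1, c) (q.1, d)) := by
      ext; simp
    exact (congrArg (fun X => S X p.2 q.2) h).trans (by rw [map_smul]; rfl)

/-- On elementary tensors, `(I_k ⊗ S) (A ⊗ B) = A ⊗ S B`. -/
theorem ampliation_kronecker {n : Type} (k : ℕ) (S : M n →ₗ[ℂ] M n) (A : M (Fin k)) (B : M n) :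
    ampliation k S (A ⊗ₖ B) = A ⊗ₖ S B := by
  ext p q
  have h : (Matrix.of fun c d => (A ⊗ₖ B) (p.1, c) (q.1, d) : M n) = A p.1 q.1 • B := by
    ext; simp
  change S (Matrix.of fun c d => (A ⊗ₖ B) (p.1, c) (q.1, d)) p.2 q.2 = _
  rw [h]
  simp

/-- `S` is `k`-positive: `S` is positive, and so is `I_k ⊗ S`. -/
def IsKPositive {n : Type} (k : ℕ) (S : M n →ₗ[ℂ] M n) : Prop :=
  IsPositive S ∧ IsPositive (ampliation k S)

/-- `S` is completely positive if it is `k`-positive for every `k`. -/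
def IsCompletelyPositive {n : Type} (S : M n →ₗ[ℂ] M n) : Prop :=
  ∀ k : ℕ, IsKPositive k S

/-- The transposition map `t : A ↦ Aᵗ` on `M_n`. -/
def transposition (n : Type) : M n →ₗ[ℂ] M n :=
  (Matrix.transposeLinearEquiv n n ℂ ℂ).toLinearMap

/-- `S` is completely copositive if `S ∘ t` is completely positive. -/
def IsCompletelyCopositive {n : Type} (S : M n →ₗ[ℂ] M n) : Prop :=
  IsCompletelyPositive (S ∘ₗ transposition n)

/-- `S` is bistochastic: positive, unital and trace-preserving. -/
def IsBistochastic {n : Type} [Fintype n] [DecidableEq n] (S : M n →ₗ[ℂ] M n) : Prop :=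
  IsPositive S ∧ S 1 = 1 ∧ ∀ X : M n, (S X).trace = X.trace

/-- The orthonormal basis of `M₂` consisting of the normalised identity and the normalised Pauli
matrices. -/
noncomputable def pauli : Fin 4 → M (Fin 2) :=
  ![((√2 : ℝ) : ℂ)⁻¹ • !![1, 0; 0, 1],
    ((√2 : ℝ) : ℂ)⁻¹ • !![0, 1; 1, 0],
    ((√2 : ℝ) : ℂ)⁻¹ • !![0, -Complex.I; Complex.I, 0],
    ((√2 : ℝ) : ℂ)⁻¹ • !![1, 0; 0, -1]]

/-- The Hermitian matrix `σ(x) = ∑ μ, x_μ σ_μ` of `x ∈ ℝ⁴`. -/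
noncomputable def sigma (x : Fin 4 → ℝ) : M (Fin 2) :=
  ∑ μ, (x μ : ℂ) • pauli μ

/-- The real `4 × 4` matrix `π(S)` of a (Hermitian) map `S` of `M₂`, with entries
`Tr (σ_μ S(σ_ν))`. By `eq_piMatrix_iff`, for Hermitian `S` it is the unique real matrix with
`σ(π(S) x) = S(σ(x))` for all `x ∈ ℝ⁴`. -/
noncomputable def piMatrix (S : M (Fin 2) →ₗ[ℂ] M (Fin 2)) : Matrix (Fin 4) (Fin 4) ℝ :=
  Matrix.of fun μ ν => (pauli μ * S (pauli ν)).trace.re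

theorem inv_sqrt_two_mul_self : ((√2 : ℝ) : ℂ)⁻¹ * ((√2 : ℝ) : ℂ)⁻¹ = 1 / 2 := by
  rw [← mul_inv, ← Complex.ofReal_mul, Real.mul_self_sqrt (by norm_num)]
  norm_num

theorem pauli_conjTranspose (μ : Fin 4) : (pauli μ)ᴴ = pauli μ := by
  fin_cases μ <;> ext i j <;> fin_cases i <;> fin_cases j <;>
    simp [pauli, Matrix.conjTranspose_apply]

theorem trace_pauli_mul_pauli (μ ν : Fin 4) :
    (pauli μ * pauli ν).trace = if μ = ν then 1 else 0 := by
  have h := inv_sqrt_two_mul_self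
  fin_cases μ <;> fin_cases ν <;>
    simp [pauli, Matrix.trace_fin_two] <;>
    grind [Complex.I_mul_I]

theorem trace_pauli_mul_sigma (μ : Fin 4) (x : Fin 4 → ℝ) :
    (pauli μ * sigma x).trace = x μ := by
  simp [sigma, Finset.mul_sum, Matrix.trace_sum, Matrix.trace_smul, trace_pauli_mul_pauli]

theorem sigma_of_isHermitian (A : M (Fin 2)) (hA : Aᴴ = A) :
    sigma (fun μ => (pauli μ * A).trace.re) = A := by
  have h := inv_sqrt_two_mul_self
  have h00 : star (A 0 0) = A 0 0 := by simpa using congrFun (congrFun hA 0) 0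
  have h11 : star (A 1 1) = A 1 1 := by simpa using congrFun (congrFun hA 1) 1
  have h01 : star (A 1 0) = A 0 1 := by simpa using congrFun (congrFun hA 0) 1
  have key : ∀ μ, (((pauli μ * A).trace.re : ℝ) : ℂ) = (pauli μ * A).trace := by
    intro μ
    apply Complex.conj_eq_iff_re.mp
    have := Matrix.trace_conjTranspose (pauli μ * A)
    rw [Matrix.conjTranspose_mul, hA, pauli_conjTranspose, Matrix.trace_mul_comm] at this
    exact this.symm
  unfold sigma
  simp only [key]
  ext i j
  fin_cases i <;> fin_cases j <;>
    simp [Fin.sum_univ_four, pauli, Matrix.trace_fin_two, Matrix.mul_apply] <;>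
    grind [Complex.I_mul_I]

/-- The defining property of `π(S)`. -/
theorem eq_piMatrix_iff (S : M (Fin 2) →ₗ[ℂ] M (Fin 2)) (hS : IsHermitianMap S)
    (P : Matrix (Fin 4) (Fin 4) ℝ) :
    P = piMatrix S ↔ ∀ x : Fin 4 → ℝ, sigma (P *ᵥ x) = S (sigma x) := by
  constructor
  · rintro rfl x
    have hx : (sigma x)ᴴ = sigma x := by
      simp [sigma, Matrix.conjTranspose_sum, Matrix.conjTranspose_smul, pauli_conjTranspose]
    rw [← sigma_of_isHermitian (S (sigma x)) (by rw [← hS, hx])]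
    congr 1
    ext μ
    simp [piMatrix, sigma, Matrix.mulVec, dotProduct, Finset.mul_sum, Matrix.trace_sum,
      Matrix.trace_smul, mul_comm]
  · intro h
    ext μ ν
    have h1 : sigma (Pi.single ν 1) = pauli ν := by
      simp [sigma, Pi.single_apply]
    have h2 := trace_pauli_mul_sigma μ (P *ᵥ Pi.single ν 1)
    rw [h, h1] at h2
    simp [piMatrix, h2]

/-- The spatial `3 × 3` block, with indices `1, 2, 3`, of a `4 × 4` matrix indexed by
`0, 1, 2, 3`. -/
def spatialBlock (P : Matrix (Fin 4) (Fin 4) ℝ) : Matrix (Fin 3) (Fin 3) ℝ :=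
  P.submatrix Fin.succ Fin.succ

/-- The set of all bistochastic maps of `M₂`. Linear maps of `M₂` are automatically continuous;
they are taken in `M₂ →L[ℂ] M₂`, which carries the topology of the operator norm. -/
def bistochasticMaps : Set (M (Fin 2) →L[ℂ] M (Fin 2)) :=
  {S | IsBistochastic (S : M (Fin 2) →ₗ[ℂ] M (Fin 2))}

/-- The set of the bistochastic maps of `M₂` that are both completely positive and completely
copositive. -/
def bistochasticCPCoCP : Set (M (Fin 2) →L[ℂ] M (Fin 2)) :=
  {S | S ∈ bistochasticMaps ∧ IsCompletelyPositive (S : M (Fin 2) →ₗ[ℂ] M (Fin 2)) ∧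
    IsCompletelyCopositive (S : M (Fin 2) →ₗ[ℂ] M (Fin 2))}

/-- The closed unit ball of `M₃(ℝ)` in the operator norm (for the Euclidean norm of `ℝ³`). -/
def operatorBall : Set (Matrix (Fin 3) (Fin 3) ℝ) :=
  {Y | ‖Matrix.toEuclideanCLM (𝕜 := ℝ) Y‖ ≤ 1}

/-- The trace norm of a real `3 × 3` matrix: the sum of its three singular values. -/
noncomputable def traceNorm (Y : Matrix (Fin 3) (Fin 3) ℝ) : ℝ :=
  ∑ i : Fin 3, (Matrix.toEuclideanLin (𝕜 := ℝ) Y).singularValues i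

/-- The closed unit ball of `M₃(ℝ)` in the trace norm. -/
def traceBall : Set (Matrix (Fin 3) (Fin 3) ℝ) :=
  {Y | traceNorm Y ≤ 1}

end QubitMaps

/-!
In Bloch coordinates a Hermitian `2 × 2` matrix is `a + v · s`, with `a ∈ ℝ`, `v ∈ ℝ³` and `s` the
Pauli matrices, and it is positive-semidefinite exactly when `|v| ≤ a` (`posSemidef_bloch_iff`).
A bistochastic map fixes `1` and preserves the trace, so it is determined by its action
`Y = F(S)` on the vectors `v`: it equals `blochMap Y` (`IsBistochastic.eq_blochMap`). Positivity of
`blochMap Y` says that `Y` preserves the light cone `|v| ≤ a`, that is, `‖Y‖ ≤ 1`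
(`isBistochastic_blochMap_iff`). Both `F` and `blochMap` are affine and continuous, which gives the
homeomorphism.

For the trace ball, complete positivity of `blochMap Y` is equivalent to positivity of its Choi
matrix `(1 + ∑ Y_ij s_jᵗ ⊗ s_i) / 2` (`IsCompletelyPositive.posSemidef_choi`,
`isCompletelyPositive_of_posSemidef_choi`, `choi_blochMap`), and composing with the transposition
replaces `Y` by `Y * reflection`, where `reflection = diag(1, -1, 1)` has determinant `-1`.
* If `‖Y‖₁ ≤ 1`, the singular value decomposition writes `Y` as a sub-convex combination of
  matrices `u vᵗ` with unit vectors `u`, `v`. For these the Choi matrix is a projection, so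
  `blochMap Y` is completely positive; the same holds for `Y * reflection`.
* For a rotation `R` the Choi matrix is twice a projection
  (`posSemidef_one_add_spinTensor_rotation`), so pairing it with the Choi matrix of a completely
  positive `blochMap Y` gives `-1 ≤ Tr(Yᵗ R)`. Using also complete copositivity, this holds for
  every orthogonal matrix, and hence `Tr(Yᵗ O) ≤ 1` for every orthogonal `O`. The choice
  `O = U Vᵗ`, where `Y = U diag(t) Vᵗ` is the singular value decomposition, turns the left-hand
  side into `‖Y‖₁`.
-/

namespace QubitMaps

/-! ### Bloch coordinates -/

/-- The Pauli matrices, without the normalisation that `pauli` carries. -/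
noncomputable def spin : Fin 3 → M (Fin 2) :=
  ![!![0, 1; 1, 0], !![0, -Complex.I; Complex.I, 0], !![1, 0; 0, -1]]

/-- The traceless Hermitian matrix `∑ i, v_i s_i` with Bloch vector `v`. -/
noncomputable def bloch (v : Fin 3 → ℝ) : M (Fin 2) :=
  ∑ i, (v i : ℂ) • spin i

/-- The map of `M₂` that fixes `1` and acts on Bloch vectors as `Y`. -/
noncomputable def blochMap (Y : Matrix (Fin 3) (Fin 3) ℝ) : M (Fin 2) →ₗ[ℂ] M (Fin 2) where
  toFun X := (1 / 2 : ℂ) • (X.trace • 1 + ∑ i, ∑ j, ((Y i j : ℂ) * (spin j * X).trace) • spin i)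
  map_add' A B := by
    simp only [trace_add, mul_add, add_smul, Finset.sum_add_distrib, smul_add]
    abel
  map_smul' z A := by
    simp only [trace_smul, Matrix.mul_smul, smul_eq_mul, mul_left_comm _ z, mul_smul,
      ← Finset.smul_sum, ← smul_add, RingHom.id_apply]
    rw [smul_comm]

theorem blochMap_apply (Y : Matrix (Fin 3) (Fin 3) ℝ) (X : M (Fin 2)) :
    blochMap Y X =
      (1 / 2 : ℂ) • (X.trace • 1 + ∑ i, ∑ j, ((Y i j : ℂ) * (spin j * X).trace) • spin i) :=
  rfl

theorem pauli_succ (i : Fin 3) : pauli i.succ = ((√2 : ℝ) : ℂ)⁻¹ • spin i := by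
  fin_cases i <;> simp [pauli, spin]

theorem trace_spin (i : Fin 3) : (spin i).trace = 0 := by
  fin_cases i <;> simp [spin, Matrix.trace_fin_two]

theorem spin_conjTranspose (i : Fin 3) : (spin i)ᴴ = spin i := by
  fin_cases i <;> ext a b <;> fin_cases a <;> fin_cases b <;>
    simp [spin, Matrix.conjTranspose_apply]

theorem trace_spin_mul_spin (i j : Fin 3) :
    (spin i * spin j).trace = if i = j then 2 else 0 := by
  fin_cases i <;> fin_cases j <;> simp [spin, Matrix.trace_fin_two]
  all_goals norm_num

theorem bloch_eq (v : Fin 3 → ℝ) :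
    bloch v = !![(v 2 : ℂ), v 0 - v 1 * Complex.I; v 0 + v 1 * Complex.I, -v 2] := by
  ext a b
  fin_cases a <;> fin_cases b <;> simp [bloch, spin, Fin.sum_univ_three]
  ring

theorem trace_bloch (v : Fin 3 → ℝ) : (bloch v).trace = 0 := by
  simp [bloch, trace_sum, trace_spin]

theorem bloch_conjTranspose (v : Fin 3 → ℝ) : (bloch v)ᴴ = bloch v := by
  simp [bloch, conjTranspose_sum, spin_conjTranspose]

theorem trace_spin_mul_bloch (i : Fin 3) (v : Fin 3 → ℝ) :
    (spin i * bloch v).trace = 2 * v i := by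
  simp [bloch, Finset.mul_sum, trace_sum, trace_spin_mul_spin, mul_comm]

theorem bloch_mul_bloch_self (v : Fin 3 → ℝ) :
    bloch v * bloch v = ((v ⬝ᵥ v : ℝ) : ℂ) • 1 := by
  rw [bloch_eq]
  ext a b
  fin_cases a <;> fin_cases b <;>
    simp [dotProduct, Fin.sum_univ_three] <;> grind [Complex.I_mul_I]

theorem pauli_expansion (X : M (Fin 2)) :
    X = (1 / 2 : ℂ) • (X.trace • 1 + ∑ i, (spin i * X).trace • spin i) := by
  ext a b
  fin_cases a <;> fin_cases b <;>
    simp [Fin.sum_univ_three, spin, trace_fin_two, vecMul, dotProduct, Fin.sum_univ_two] <;>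
    grind [Complex.I_mul_I]

theorem isHermitian_expansion {A : M (Fin 2)} (hA : Aᴴ = A) :
    A = ((A.trace.re / 2 : ℝ) : ℂ) • 1 + bloch fun i => (spin i * A).trace.re / 2 := by
  have h1 : ((A.trace.re : ℝ) : ℂ) = A.trace :=
    Complex.conj_eq_iff_re.mp (by rw [starRingEnd_apply, ← trace_conjTranspose, hA])
  have h2 (i) : (((spin i * A).trace.re : ℝ) : ℂ) = (spin i * A).trace :=
    Complex.conj_eq_iff_re.mp (by
      rw [starRingEnd_apply, ← trace_conjTranspose, conjTranspose_mul, hA, spin_conjTranspose,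
        trace_mul_comm])
  conv_lhs => rw [pauli_expansion A]
  simp only [bloch, Complex.ofReal_div, h1, h2, smul_add, Finset.smul_sum, smul_smul]
  congr 1
  · congr 1
    push_cast
    ring
  · refine Finset.sum_congr rfl fun i _ => ?_
    congr 1
    push_cast
    ring

/-! ### The positive cone and positive maps -/

/-- In Bloch coordinates the positive-semidefinite matrices form the forward light cone. -/
theorem posSemidef_bloch_iff (a : ℝ) (v : Fin 3 → ℝ) :
    ((a : ℂ) • (1 : M (Fin 2)) + bloch v).PosSemidef ↔ 0 ≤ a ∧ v ⬝ᵥ v ≤ a ^ 2 := by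
  have hdet : ((a : ℂ) • (1 : M (Fin 2)) + bloch v).det = ((a ^ 2 - v ⬝ᵥ v : ℝ) : ℂ) := by
    rw [bloch_eq, det_fin_two]
    simp [dotProduct, Fin.sum_univ_three]
    grind [Complex.I_mul_I]
  constructor
  · intro h
    have h1 := h.trace_nonneg
    have h2 := h.det_nonneg
    rw [hdet, Complex.zero_le_real] at h2
    have h3 : ((a : ℂ) • (1 : M (Fin 2)) + bloch v).trace = ((a * 2 : ℝ) : ℂ) := by
      simp [trace_bloch]
    rw [h3, Complex.zero_le_real] at h1
    constructor <;> linarith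
  · rintro ⟨ha, hv⟩
    rcases ha.eq_or_lt with rfl | ha
    · have : v = 0 := by
        rw [← dotProduct_self_eq_zero]
        exact le_antisymm (by simpa using hv) (by simp [dotProduct, ← sq]; positivity)
      subst this
      simpa [bloch] using PosSemidef.zero
    · -- Cayley–Hamilton: `H = (H² + det H) / (2 a)`.
      set H := (a : ℂ) • (1 : M (Fin 2)) + bloch v with hH
      have hHH : Hᴴ = H := by simp [hH, bloch_conjTranspose]
      have ha' : (a : ℂ) ≠ 0 := by exact_mod_cast ha.ne'
      have key : H = ((1 / (2 * a) : ℝ) : ℂ) •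
          (Hᴴ * H + ((a ^ 2 - v ⬝ᵥ v : ℝ) : ℂ) • (1 : M (Fin 2))) := by
        rw [hHH, hH]
        simp only [add_mul, mul_add, bloch_mul_bloch_self, smul_mul_assoc, mul_smul_comm, one_mul,
          mul_one, smul_add, smul_smul]
        push_cast
        match_scalars <;> field_simp <;> ring
      rw [key]
      refine ((posSemidef_conjTranspose_mul_self H).add (PosSemidef.one.smul ?_)).smul ?_
      · rw [Complex.zero_le_real]; linarith
      · rw [Complex.zero_le_real]; positivity

theorem blochMap_bloch (Y : Matrix (Fin 3) (Fin 3) ℝ) (a : ℝ) (v : Fin 3 → ℝ) :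
    blochMap Y ((a : ℂ) • (1 : M (Fin 2)) + bloch v) = (a : ℂ) • 1 + bloch (Y *ᵥ v) := by
  rw [blochMap_apply]
  simp only [trace_add, trace_smul, trace_one, trace_bloch, mul_add, mul_smul_comm, mul_one,
    trace_spin, trace_spin_mul_bloch]
  simp only [bloch, mulVec, dotProduct, Complex.ofReal_sum,
    Finset.sum_smul, smul_add, Finset.smul_sum, smul_smul]
  congr 1
  · congr 1
    simp [mul_comm]
  · refine Finset.sum_congr rfl fun i _ => Finset.sum_congr rfl fun j _ => ?_
    congr 1
    push_cast
    simp
    ring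

theorem isPositive_blochMap_iff (Y : Matrix (Fin 3) (Fin 3) ℝ) :
    IsPositive (blochMap Y) ↔ ∀ v : Fin 3 → ℝ, (Y *ᵥ v) ⬝ᵥ (Y *ᵥ v) ≤ v ⬝ᵥ v := by
  constructor
  · intro h v
    have hv : 0 ≤ v ⬝ᵥ v := by simp [dotProduct, ← sq]; positivity
    have h1 := h _ ((posSemidef_bloch_iff (√(v ⬝ᵥ v)) v).2
      ⟨Real.sqrt_nonneg _, (Real.sq_sqrt hv).ge⟩)
    rw [blochMap_bloch, posSemidef_bloch_iff, Real.sq_sqrt hv] at h1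
    exact h1.2
  · intro h A hA
    have hA' := isHermitian_expansion hA.1
    rw [hA', posSemidef_bloch_iff] at hA
    rw [hA', blochMap_bloch, posSemidef_bloch_iff]
    exact ⟨hA.1, (h _).trans hA.2⟩

theorem mem_operatorBall_iff (Y : Matrix (Fin 3) (Fin 3) ℝ) :
    Y ∈ operatorBall ↔ ∀ v : Fin 3 → ℝ, (Y *ᵥ v) ⬝ᵥ (Y *ᵥ v) ≤ v ⬝ᵥ v := by
  have key (v : Fin 3 → ℝ) : v ⬝ᵥ v = ‖WithLp.toLp 2 v‖ ^ 2 := by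
    rw [EuclideanSpace.norm_sq_eq]
    simp [dotProduct, ← sq]
  rw [operatorBall, Set.mem_ofPred_eq, ContinuousLinearMap.opNorm_le_iff zero_le_one]
  constructor
  · intro h v
    rw [key, key]
    have := h (WithLp.toLp 2 v)
    rw [one_mul] at this
    exact pow_le_pow_left₀ (norm_nonneg _) this 2
  · intro h x
    have := h x.ofLp
    rw [key, key] at this
    rw [one_mul]
    exact le_of_sq_le_sq this (norm_nonneg _)

/-! ### Bistochastic maps -/

theorem blochMap_one (Y : Matrix (Fin 3) (Fin 3) ℝ) : blochMap Y 1 = 1 := by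
  simpa [bloch] using blochMap_bloch Y 1 0

theorem trace_blochMap (Y : Matrix (Fin 3) (Fin 3) ℝ) (X : M (Fin 2)) :
    (blochMap Y X).trace = X.trace := by
  simp [blochMap_apply, trace_sum, trace_spin]
  ring

theorem isBistochastic_blochMap_iff (Y : Matrix (Fin 3) (Fin 3) ℝ) :
    IsBistochastic (blochMap Y) ↔ Y ∈ operatorBall := by
  rw [mem_operatorBall_iff, ← isPositive_blochMap_iff]
  exact ⟨fun h => h.1, fun h => ⟨h, blochMap_one Y, trace_blochMap Y⟩⟩

theorem piMatrix_succ_succ (S : M (Fin 2) →ₗ[ℂ] M (Fin 2)) (i j : Fin 3) :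
    spatialBlock (piMatrix S) i j = (spin i * S (spin j)).trace.re / 2 := by
  have h : (1 / 2 : ℂ) = ((1 / 2 : ℝ) : ℂ) := by norm_num
  simp only [spatialBlock, piMatrix, submatrix_apply, of_apply, pauli_succ, map_smul,
    smul_mul_assoc, mul_smul_comm, smul_smul, trace_smul, inv_sqrt_two_mul_self, smul_eq_mul]
  rw [h, Complex.re_ofReal_mul]
  ring

theorem spatialBlock_piMatrix_blochMap (Y : Matrix (Fin 3) (Fin 3) ℝ) :
    spatialBlock (piMatrix (blochMap Y)) = Y := by
  ext i j
  have h : spin j = ((0 : ℝ) : ℂ) • (1 : M (Fin 2)) + bloch (Pi.single j 1) := by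
    simp [bloch, Pi.single_apply]
  rw [piMatrix_succ_succ, h, blochMap_bloch]
  simp [trace_spin_mul_bloch]

/-- A Hermitian matrix `A` is the difference of the positive-semidefinite matrices `A + c` and `c`
for large `c`. -/
theorem IsPositive.conjTranspose_map {S : M (Fin 2) →ₗ[ℂ] M (Fin 2)} (hS : IsPositive S)
    {A : M (Fin 2)} (hA : Aᴴ = A) : (S A)ᴴ = S A := by
  rw [isHermitian_expansion hA]
  generalize A.trace.re / 2 = a
  generalize (fun i => (spin i * A).trace.re / 2) = v
  have hv : 0 ≤ v ⬝ᵥ v := by simp [dotProduct, ← sq]; positivity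
  set c := |a| + √(v ⬝ᵥ v) with hc
  have hc0 : 0 ≤ c := by positivity
  have h1 : (((a + c : ℝ) : ℂ) • (1 : M (Fin 2)) + bloch v).PosSemidef := by
    have h : √(v ⬝ᵥ v) ≤ a + c := by linarith [neg_abs_le a]
    refine (posSemidef_bloch_iff _ _).2 ⟨(Real.sqrt_nonneg _).trans h, ?_⟩
    calc v ⬝ᵥ v = √(v ⬝ᵥ v) ^ 2 := (Real.sq_sqrt hv).symm
      _ ≤ _ := by gcongr
  have h2 : ((c : ℂ) • (1 : M (Fin 2))).PosSemidef :=
    PosSemidef.one.smul (Complex.zero_le_real.2 hc0)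
  have h3 : (a : ℂ) • (1 : M (Fin 2)) + bloch v =
      (((a + c : ℝ) : ℂ) • (1 : M (Fin 2)) + bloch v) - (c : ℂ) • (1 : M (Fin 2)) := by
    push_cast
    rw [add_smul]
    abel
  rw [h3, map_sub, conjTranspose_sub, (hS _ h1).1.eq, (hS _ h2).1.eq]

theorem IsBistochastic.eq_blochMap {S : M (Fin 2) →ₗ[ℂ] M (Fin 2)} (hS : IsBistochastic S) :
    S = blochMap (spatialBlock (piMatrix S)) := by
  obtain ⟨hpos, hone, htr⟩ := hS
  have key (j : Fin 3) : S (spin j) =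
      ∑ i, (spatialBlock (piMatrix S) i j : ℂ) • spin i := by
    conv_lhs => rw [isHermitian_expansion (hpos.conjTranspose_map (spin_conjTranspose j)), htr,
      trace_spin]
    simp [bloch, piMatrix_succ_succ]
  ext1 X
  conv_lhs => rw [pauli_expansion X]
  simp only [map_smul, map_add, hone, map_sum, key, blochMap_apply]
  rw [Finset.sum_comm]
  simp only [Finset.smul_sum, smul_smul, mul_comm]

/-! ### Choi matrices -/

/-- The Choi matrix `∑ c d, E_cd ⊗ S E_cd` of `S`. -/
def choi {n : Type} [DecidableEq n] (S : M n →ₗ[ℂ] M n) : M (n × n) :=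
  of fun p q => S (single p.1 q.1 1) p.2 q.2

/-- The Choi matrix is the image under `I ⊗ S` of an unnormalised maximally entangled state. -/
theorem IsCompletelyPositive.posSemidef_choi {k : ℕ} {S : M (Fin k) →ₗ[ℂ] M (Fin k)}
    (hS : IsCompletelyPositive S) : (choi S).PosSemidef := by
  let ψ : Fin k × Fin k → ℂ := fun p => if p.1 = p.2 then 1 else 0
  convert! (hS k).2 _ (posSemidef_vecMulVec_self_star ψ) using 1
  ext p q
  refine congrArg (fun X => S X p.2 q.2) ?_
  ext c d
  by_cases hc : p.1 = c <;> by_cases hd : q.1 = d <;>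
    simp [ψ, single, vecMulVec_apply, hc, hd]

theorem apply_eq_sum_choi {n : Type} [Fintype n] [DecidableEq n] (S : M n →ₗ[ℂ] M n) (X : M n)
    (a b : n) : S X a b = ∑ c, ∑ d, X c d * choi S (c, a) (d, b) := by
  conv_lhs => rw [matrix_eq_sum_single X]
  have (c d : n) : single c d (X c d) = X c d • single c d 1 := by simp
  simp only [map_sum, Matrix.sum_apply, this, map_smul, Matrix.smul_apply, smul_eq_mul]
  rfl

theorem one_kronecker_congruence {n : Type} [Fintype n] {k : ℕ} (V : M n) (A : M (Fin k × n))
    (p q : Fin k) (a b : n) :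
    (((1 : M (Fin k)) ⊗ₖ V)ᴴ * A * ((1 : M (Fin k)) ⊗ₖ V)) (p, a) (q, b) =
      (Vᴴ * (of fun c d => A (p, c) (q, d)) * V) a b := by
  simp [mul_apply, Fintype.sum_prod_type, one_apply, apply_ite (starRingEnd ℂ), ite_mul,
    Finset.sum_ite_irrel]

/-- Choi's criterion: a factorisation `B* B` of the Choi matrix writes `S` as a sum of
congruences, one for each row of `B`, and then `I ⊗ S` is a sum of congruences too. -/
theorem isCompletelyPositive_of_posSemidef_choi {n : Type} [Fintype n] [DecidableEq n]
    {S : M n →ₗ[ℂ] M n} (hS : (choi S).PosSemidef) : IsCompletelyPositive S := by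
  obtain ⟨B, hB⟩ : ∃ B : M (n × n), choi S = Bᴴ * B := by
    open scoped MatrixOrder in
    obtain ⟨B, hB⟩ := CStarAlgebra.nonneg_iff_eq_star_mul_self.mp hS.nonneg
    exact ⟨B, hB⟩
  let V (r : n × n) : M n := of fun c a => B r (c, a)
  have kraus (A : M n) : S A = ∑ r, (V r)ᴴ * A * V r := by
    ext a b
    have hchoi (p q : n × n) : choi S p q = ∑ r, star (B r p) * B r q := by
      simp [hB, mul_apply, conjTranspose_apply]
    simp only [apply_eq_sum_choi, hchoi, Matrix.sum_apply, mul_apply, conjTranspose_apply,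
      of_apply, Finset.mul_sum, Finset.sum_mul, V]
    rw [Finset.sum_comm, Finset.sum_comm_cycle]
    exact Finset.sum_congr rfl fun r _ => Finset.sum_congr rfl fun d _ =>
      Finset.sum_congr rfl fun c _ => by ring
  refine fun k => ⟨fun A hA => ?_, fun A hA => ?_⟩
  · rw [kraus]
    exact posSemidef_sum _ fun r _ => hA.conjTranspose_mul_mul_same _
  · have : ampliation k S A =
        ∑ r, ((1 : M (Fin k)) ⊗ₖ V r)ᴴ * A * ((1 : M (Fin k)) ⊗ₖ V r) := by
      ext ⟨p, a⟩ ⟨q, b⟩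
      change S (of fun c d => A (p, c) (q, d)) a b = _
      simp only [kraus, Matrix.sum_apply, one_kronecker_congruence]
    rw [this]
    exact posSemidef_sum _ fun r _ => hA.conjTranspose_mul_mul_same _

/-! ### The Choi matrix in Bloch coordinates -/

/-- The correlation part `∑ i j, Y_ij s_jᵗ ⊗ s_i` of the Choi matrix of `blochMap Y`. -/
noncomputable def spinTensor (Y : Matrix (Fin 3) (Fin 3) ℝ) : M (Fin 2 × Fin 2) :=
  ∑ i, ∑ j, (Y i j : ℂ) • ((spin j)ᵀ ⊗ₖ spin i)

theorem choi_blochMap (Y : Matrix (Fin 3) (Fin 3) ℝ) :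
    choi (blochMap Y) = (1 / 2 : ℂ) • (1 + spinTensor Y) := by
  ext ⟨c, a⟩ ⟨d, b⟩
  have h : (single c d (1 : ℂ)).trace • (1 : M (Fin 2)) a b =
      (1 : M (Fin 2 × Fin 2)) (c, a) (d, b) := by
    by_cases hc : c = d <;> simp [hc, one_apply, trace_single_eq_of_ne]
  simp only [choi, blochMap_apply, of_apply, spinTensor, Matrix.smul_apply, Matrix.add_apply,
    Matrix.sum_apply, kroneckerMap_apply, transpose_apply, ← h, trace_mul_single]
  simp [mul_assoc]

/-- The sign changes by which transposition acts on Bloch vectors. -/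
def reflection : Matrix (Fin 3) (Fin 3) ℝ :=
  diagonal ![1, -1, 1]

theorem spin_transpose (j : Fin 3) : (spin j)ᵀ = ((![1, -1, 1] j : ℝ) : ℂ) • spin j := by
  fin_cases j <;> ext a b <;> fin_cases a <;> fin_cases b <;> simp [spin]

theorem blochMap_comp_transposition (Y : Matrix (Fin 3) (Fin 3) ℝ) :
    blochMap Y ∘ₗ transposition (Fin 2) = blochMap (Y * reflection) := by
  ext1 X
  have h (j : Fin 3) : (spin j * Xᵀ).trace = ((![1, -1, 1] j : ℝ) : ℂ) * (spin j * X).trace := by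
    rw [← trace_transpose, transpose_mul, transpose_transpose, trace_mul_comm, spin_transpose,
      smul_mul_assoc, trace_smul, smul_eq_mul]
  change blochMap Y Xᵀ = _
  simp only [blochMap_apply, h, trace_transpose, reflection, mul_diagonal]
  push_cast
  simp only [mul_assoc]

theorem spinTensor_add (Y Z : Matrix (Fin 3) (Fin 3) ℝ) :
    spinTensor (Y + Z) = spinTensor Y + spinTensor Z := by
  simp [spinTensor, add_smul, Finset.sum_add_distrib]

theorem spinTensor_smul (t : ℝ) (Y : Matrix (Fin 3) (Fin 3) ℝ) :
    spinTensor (t • Y) = (t : ℂ) • spinTensor Y := by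
  simp [spinTensor, Finset.smul_sum, mul_smul]

theorem spinTensor_conjTranspose (Y : Matrix (Fin 3) (Fin 3) ℝ) :
    (spinTensor Y)ᴴ = spinTensor Y := by
  have h (j : Fin 3) : (spin j)ᵀᴴ = (spin j)ᵀ := by
    rw [show (spin j)ᵀᴴ = (spin j)ᴴᵀ from rfl, spin_conjTranspose]
  simp [spinTensor, conjTranspose_sum, conjTranspose_kronecker, spin_conjTranspose, h]

theorem trace_spinTensor (Y : Matrix (Fin 3) (Fin 3) ℝ) : (spinTensor Y).trace = 0 := by
  simp [spinTensor, trace_sum, trace_kronecker, trace_spin]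

theorem trace_spinTensor_mul_spinTensor (Y Z : Matrix (Fin 3) (Fin 3) ℝ) :
    (spinTensor Y * spinTensor Z).trace = 4 * ((Yᵀ * Z).trace : ℝ) := by
  have h (i j k l : Fin 3) : (((spin j)ᵀ * (spin l)ᵀ) ⊗ₖ (spin i * spin k)).trace =
      if j = l then if i = k then 4 else 0 else 0 := by
    rw [trace_kronecker, ← transpose_mul, trace_transpose, trace_spin_mul_spin,
      trace_spin_mul_spin]
    simp only [eq_comm (a := l)]
    split_ifs <;> norm_num
  simp only [spinTensor, Finset.sum_mul, Finset.mul_sum, trace_sum, smul_mul_assoc,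
    mul_smul_comm, ← mul_kronecker_mul, trace_smul, h, smul_eq_mul]
  simp only [trace, diag, mul_apply, transpose_apply, Fin.sum_univ_three, Fin.reduceEq, if_true,
    if_false]
  push_cast
  ring

theorem spinTensor_vecMulVec (u v : Fin 3 → ℝ) :
    spinTensor (vecMulVec u v) = (bloch v)ᵀ ⊗ₖ bloch u := by
  ext ⟨c, a⟩ ⟨d, b⟩
  simp only [spinTensor, bloch, Matrix.sum_apply, Matrix.smul_apply, kroneckerMap_apply,
    transpose_apply, vecMulVec_apply, Finset.sum_mul_sum, smul_eq_mul]
  rw [Finset.sum_comm]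
  refine Finset.sum_congr rfl fun j _ => Finset.sum_congr rfl fun i _ => ?_
  push_cast
  ring

/-- The matrix is a multiple of a projection. -/
theorem posSemidef_one_add_spinTensor_vecMulVec {u v : Fin 3 → ℝ} (hu : u ⬝ᵥ u = 1)
    (hv : v ⬝ᵥ v = 1) : (1 + spinTensor (vecMulVec u v)).PosSemidef := by
  have h : spinTensor (vecMulVec u v) * spinTensor (vecMulVec u v) = 1 := by
    rw [spinTensor_vecMulVec, ← mul_kronecker_mul, ← transpose_mul, bloch_mul_bloch_self,
      bloch_mul_bloch_self, hu, hv]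
    simp
  have key : 1 + spinTensor (vecMulVec u v) = (1 / 2 : ℂ) •
      ((1 + spinTensor (vecMulVec u v))ᴴ * (1 + spinTensor (vecMulVec u v))) := by
    rw [conjTranspose_add, conjTranspose_one, spinTensor_conjTranspose, mul_add]
    simp only [add_mul, mul_one, one_mul, h]
    module
  rw [key]
  exact (posSemidef_conjTranspose_mul_self _).smul (by simp)

/-! ### Rotations -/

theorem bloch_mul_bloch (u v : Fin 3 → ℝ) :
    bloch u * bloch v = ((u ⬝ᵥ v : ℝ) : ℂ) • 1 + Complex.I • bloch (crossProduct u v) := by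
  simp only [bloch_eq]
  ext a b
  fin_cases a <;> fin_cases b <;>
    simp [dotProduct, Fin.sum_univ_three, cross_apply] <;> grind [Complex.I_mul_I]

/-- The rows of a rotation form a positively oriented orthonormal basis, so the matrices
`bloch (R i)` satisfy the relations of the Pauli matrices. -/
theorem bloch_row_relations {R : Matrix (Fin 3) (Fin 3) ℝ} (hR : R * Rᵀ = 1) (hdet : R.det = 1) :
    (∀ i, bloch (R i) * bloch (R i) = 1) ∧
    bloch (R 0) * bloch (R 1) = Complex.I • bloch (R 2) ∧
    bloch (R 1) * bloch (R 2) = Complex.I • bloch (R 0) ∧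
    bloch (R 2) * bloch (R 0) = Complex.I • bloch (R 1) ∧
    bloch (R 1) * bloch (R 0) = -Complex.I • bloch (R 2) ∧
    bloch (R 2) * bloch (R 1) = -Complex.I • bloch (R 0) ∧
    bloch (R 0) * bloch (R 2) = -Complex.I • bloch (R 1) := by
  have hdot (i j : Fin 3) : R i ⬝ᵥ R j = if i = j then 1 else 0 := by
    rw [← one_apply, ← hR]
    rfl
  have hadj : R.adjugate = Rᵀ := by
    calc R.adjugate = R.adjugate * (R * Rᵀ) := by rw [hR, mul_one]
      _ = Rᵀ := by rw [← mul_assoc, adjugate_mul, hdet, one_smul, one_mul]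
  rw [adjugate_fin_three] at hadj
  have h (i j : Fin 3) := congrFun (congrFun hadj i) j
  have h01 : crossProduct (R 0) (R 1) = R 2 := by
    ext i
    have := h i 2
    fin_cases i <;> simp [cross_apply] at this ⊢ <;> linarith
  have h12 : crossProduct (R 1) (R 2) = R 0 := by
    ext i
    have := h i 0
    fin_cases i <;> simp [cross_apply] at this ⊢ <;> linarith
  have h20 : crossProduct (R 2) (R 0) = R 1 := by
    ext i
    have := h i 1
    fin_cases i <;> simp [cross_apply] at this ⊢ <;> linarith
  have hneg (v : Fin 3 → ℝ) : bloch (-v) = -bloch v := by simp [bloch]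
  have h10 : crossProduct (R 1) (R 0) = -R 2 := by rw [← cross_anticomm, h01]
  have h21 : crossProduct (R 2) (R 1) = -R 0 := by rw [← cross_anticomm, h12]
  have h02 : crossProduct (R 0) (R 2) = -R 1 := by rw [← cross_anticomm, h20]
  refine ⟨fun i => ?_, ?_, ?_, ?_, ?_, ?_, ?_⟩
  · simp [bloch_mul_bloch_self, hdot]
  all_goals simp [bloch_mul_bloch, hdot, h01, h12, h20, h10, h21, h02, hneg]

theorem spinTensor_mul_self_of_rotation {R : Matrix (Fin 3) (Fin 3) ℝ} (hR : R * Rᵀ = 1)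
    (hdet : R.det = 1) : spinTensor R * spinTensor R = (3 : ℂ) • 1 + (2 : ℂ) • spinTensor R := by
  have hexp : spinTensor R = (bloch (R 0))ᵀ ⊗ₖ bloch ((1 : Matrix (Fin 3) (Fin 3) ℝ) 0) +
      (bloch (R 1))ᵀ ⊗ₖ bloch ((1 : Matrix (Fin 3) (Fin 3) ℝ) 1) +
      (bloch (R 2))ᵀ ⊗ₖ bloch ((1 : Matrix (Fin 3) (Fin 3) ℝ) 2) := by
    have : R = vecMulVec ((1 : Matrix (Fin 3) (Fin 3) ℝ) 0) (R 0) +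
        vecMulVec ((1 : Matrix (Fin 3) (Fin 3) ℝ) 1) (R 1) +
        vecMulVec ((1 : Matrix (Fin 3) (Fin 3) ℝ) 2) (R 2) := by
      ext i j
      fin_cases i <;> simp [vecMulVec_apply]
    conv_lhs => rw [this]
    simp only [spinTensor_add, spinTensor_vecMulVec]
  obtain ⟨hsq, h01, h12, h20, h10, h21, h02⟩ := bloch_row_relations hR hdet
  obtain ⟨gsq, g01, g12, g20, g10, g21, g02⟩ :=
    bloch_row_relations (R := 1) (by simp) (by simp)
  rw [hexp]
  simp only [add_mul, mul_add, ← mul_kronecker_mul, ← transpose_mul, hsq, h01, h12, h20, h10, h21,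
    h02, gsq, g01, g12, g20, g10, g21, g02, transpose_smul, smul_kronecker, kronecker_smul,
    smul_smul, transpose_one, one_kronecker_one, mul_neg, neg_mul, Complex.I_mul_I, neg_neg]
  module

/-- For a rotation `R`, the matrix is four times a projection. -/
theorem posSemidef_one_add_spinTensor_rotation {R : Matrix (Fin 3) (Fin 3) ℝ} (hR : R * Rᵀ = 1)
    (hdet : R.det = 1) : (1 + spinTensor R).PosSemidef := by
  have key : 1 + spinTensor R = (1 / 4 : ℂ) • ((1 + spinTensor R)ᴴ * (1 + spinTensor R)) := by
    rw [conjTranspose_add, conjTranspose_one, spinTensor_conjTranspose, mul_add]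
    simp only [add_mul, mul_one, one_mul, spinTensor_mul_self_of_rotation hR hdet]
    module
  rw [key]
  exact (posSemidef_conjTranspose_mul_self _).smul (by simp)

/-! ### Singular value decomposition -/

/-- Singular value decomposition: take an orthonormal eigenbasis `b` of `T* T`; the vectors
`T (b i)` are orthogonal with norms the singular values, and the nonzero ones are normalised and
completed to an orthonormal basis. -/
theorem exists_orthonormalBasis_singularValues {E F : Type*} [NormedAddCommGroup E]
    [InnerProductSpace ℝ E] [FiniteDimensional ℝ E] [NormedAddCommGroup F] [InnerProductSpace ℝ F]
    [FiniteDimensional ℝ F] {n : ℕ} (hE : Module.finrank ℝ E = n) (hF : Module.finrank ℝ F = n)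
    (T : E →ₗ[ℝ] F) :
    ∃ (b : OrthonormalBasis (Fin n) ℝ E) (c : OrthonormalBasis (Fin n) ℝ F),
      ∀ i, T (b i) = T.singularValues i • c i := by
  have hsym := T.isSymmetric_adjoint_comp_self
  let b := hsym.eigenvectorBasis hE
  have hinner (i j : Fin n) :
      inner ℝ (T (b i)) (T (b j)) = if i = j then T.singularValues i ^ 2 else 0 := by
    rw [← LinearMap.adjoint_inner_right, ← LinearMap.comp_apply, hsym.apply_eigenvectorBasis hE j,
      inner_smul_right, orthonormal_iff_ite.mp b.orthonormal, T.sq_singularValues_fin hE]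
    split_ifs with h
    · subst h; simp
    · simp
  let s : Set (Fin n) := {i | T.singularValues i ≠ 0}
  have hon : Orthonormal ℝ (s.domRestrict fun i => (T.singularValues i)⁻¹ • T (b i)) := by
    rw [orthonormal_iff_ite]
    rintro ⟨i, hi⟩ ⟨j, hj⟩
    change inner ℝ ((T.singularValues i)⁻¹ • T (b i)) ((T.singularValues j)⁻¹ • T (b j)) = _
    rw [real_inner_smul_left, real_inner_smul_right, hinner]
    by_cases h : i = j
    · subst h
      have : T.singularValues i ≠ 0 := hi
      rw [if_pos rfl, if_pos rfl]
      field_simp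
    · simp [h]
  obtain ⟨c, hc⟩ := hon.exists_orthonormalBasis_extension_of_card_eq (by simp [hF])
  refine ⟨b, c, fun i => ?_⟩
  by_cases hi : T.singularValues i = 0
  · have := hinner i i
    rw [if_pos rfl, hi, zero_pow two_ne_zero, inner_self_eq_zero] at this
    rw [this, hi, zero_smul]
  · rw [hc i hi, smul_smul, mul_inv_cancel₀ hi, one_smul]

theorem exists_singularValue_factorization (Y : Matrix (Fin 3) (Fin 3) ℝ) :
    ∃ (U V : Matrix (Fin 3) (Fin 3) ℝ) (t : Fin 3 → ℝ), Uᵀ * U = 1 ∧ Vᵀ * V = 1 ∧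
      (∀ i, 0 ≤ t i) ∧ traceNorm Y = ∑ i, t i ∧ Y = U * diagonal t * Vᵀ := by
  obtain ⟨b, c, h⟩ := exists_orthonormalBasis_singularValues (finrank_euclideanSpace_fin (n := 3))
    (finrank_euclideanSpace_fin (n := 3)) (toEuclideanLin (𝕜 := ℝ) Y)
  have horth (e : OrthonormalBasis (Fin 3) ℝ (EuclideanSpace ℝ (Fin 3))) :
      (of fun k i => e i k)ᵀ * (of fun k i => e i k) = (1 : Matrix (Fin 3) (Fin 3) ℝ) := by
    ext i j
    rw [one_apply, ← orthonormal_iff_ite.mp e.orthonormal i j]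
    simp [mul_apply, PiLp.inner_apply, mul_comm]
  refine ⟨of fun k i => c i k, of fun k i => b i k,
    fun i => (toEuclideanLin (𝕜 := ℝ) Y).singularValues i, horth c, horth b,
    fun i => LinearMap.singularValues_nonneg _ _, rfl, ?_⟩
  set V : Matrix (Fin 3) (Fin 3) ℝ := of fun k i => b i k
  have hYV : Y * V = (of fun k i => c i k) *
      diagonal fun i : Fin 3 => (toEuclideanLin (𝕜 := ℝ) Y).singularValues i := by
    ext k i
    have := congrArg (fun x : EuclideanSpace ℝ (Fin 3) => x k) (h i)
    rw [mul_diagonal, of_apply, mul_comm]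
    exact this
  rw [← hYV, mul_assoc, mul_eq_one_comm.mp (horth b), mul_one]

theorem mul_diagonal_mul_transpose_eq_sum (U V : Matrix (Fin 3) (Fin 3) ℝ) (t : Fin 3 → ℝ) :
    U * diagonal t * Vᵀ = ∑ i, t i • vecMulVec (Uᵀ i) (Vᵀ i) := by
  ext a b
  rw [mul_apply]
  simp only [mul_diagonal, Matrix.sum_apply, Matrix.smul_apply, vecMulVec_apply, transpose_apply,
    smul_eq_mul]
  exact Finset.sum_congr rfl fun i _ => by ring

/-! ### The trace ball -/

/-- A matrix in the trace ball is a sub-convex combination of matrices `u vᵗ` with unit vectors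
`u` and `v`; the missing weight goes to the completely depolarising map. -/
theorem isCompletelyPositive_blochMap_of_factorization {U V : Matrix (Fin 3) (Fin 3) ℝ}
    {t : Fin 3 → ℝ} (hU : Uᵀ * U = 1) (hV : Vᵀ * V = 1) (ht : ∀ i, 0 ≤ t i) (hsum : ∑ i, t i ≤ 1) :
    IsCompletelyPositive (blochMap (U * diagonal t * Vᵀ)) := by
  apply isCompletelyPositive_of_posSemidef_choi
  have hunit {W : Matrix (Fin 3) (Fin 3) ℝ} (hW : Wᵀ * W = 1) (i : Fin 3) : Wᵀ i ⬝ᵥ Wᵀ i = 1 := by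
    have := congrFun (congrFun hW i) i
    rwa [one_apply_eq] at this
  have key : 1 + spinTensor (U * diagonal t * Vᵀ) =
      ((1 - ∑ i, t i : ℝ) : ℂ) • (1 : M (Fin 2 × Fin 2)) +
        ∑ i, (t i : ℂ) • (1 + spinTensor (vecMulVec (Uᵀ i) (Vᵀ i))) := by
    rw [mul_diagonal_mul_transpose_eq_sum]
    simp only [Fin.sum_univ_three, spinTensor_add, spinTensor_smul]
    push_cast
    module
  rw [choi_blochMap, key]
  refine PosSemidef.smul (.add (PosSemidef.one.smul ?_) (posSemidef_sum _ fun i _ =>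
    (posSemidef_one_add_spinTensor_vecMulVec (hunit hU i) (hunit hV i)).smul ?_)) (by simp)
  · rw [Complex.zero_le_real]; linarith
  · rw [Complex.zero_le_real]; exact ht i

theorem trace_mul_nonneg_of_posSemidef {n : Type} [Fintype n] {A B : M n}
    (hA : A.PosSemidef) (hB : B.PosSemidef) : 0 ≤ (A * B).trace := by
  classical
  obtain ⟨D, hD⟩ : ∃ D : M n, B = Dᴴ * D := by
    open scoped MatrixOrder in
    obtain ⟨D, hD⟩ := CStarAlgebra.nonneg_iff_eq_star_mul_self.mp hB.nonneg
    exact ⟨D, hD⟩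
  rw [hD, ← mul_assoc, trace_mul_comm, ← mul_assoc]
  exact (hA.mul_mul_conjTranspose_same D).trace_nonneg

/-- The Choi matrices of a completely positive map and of a rotation have a nonnegative
Hilbert–Schmidt product. -/
theorem IsCompletelyPositive.neg_one_le_trace {Y R : Matrix (Fin 3) (Fin 3) ℝ}
    (hY : IsCompletelyPositive (blochMap Y)) (hR : R * Rᵀ = 1) (hdet : R.det = 1) :
    -1 ≤ (Yᵀ * R).trace := by
  have h := trace_mul_nonneg_of_posSemidef hY.posSemidef_choi
    (posSemidef_one_add_spinTensor_rotation hR hdet)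
  have h2 : (choi (blochMap Y) * (1 + spinTensor R)).trace =
      ((2 + 2 * (Yᵀ * R).trace : ℝ) : ℂ) := by
    rw [choi_blochMap, smul_mul_assoc, trace_smul, add_mul, mul_add, mul_add]
    simp only [one_mul, mul_one, trace_add, trace_spinTensor, trace_spinTensor_mul_spinTensor,
      trace_one, Fintype.card_prod, Fintype.card_fin]
    push_cast
    simp only [smul_eq_mul]
    ring
  rw [h2, Complex.zero_le_real] at h
  linarith

theorem reflection_mul_reflection : reflection * reflection = 1 := by
  rw [reflection, diagonal_mul_diagonal, ← diagonal_one]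
  congr 1
  ext i
  fin_cases i <;> simp

theorem reflection_transpose : reflectionᵀ = reflection := diagonal_transpose _

theorem det_reflection : reflection.det = -1 := by
  simp [reflection, det_diagonal, Fin.prod_univ_three]

/-- Of an orthogonal matrix `O`, either `-O` or `-O * reflection` is a rotation. -/
theorem trace_transpose_mul_le_one {Y O : Matrix (Fin 3) (Fin 3) ℝ}
    (hcp : IsCompletelyPositive (blochMap Y))
    (hcocp : IsCompletelyPositive (blochMap (Y * reflection)))
    (hO : O * Oᵀ = 1) : (Yᵀ * O).trace ≤ 1 := by
  have hdet : O.det = 1 ∨ O.det = -1 := by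
    have := congrArg det hO
    rw [det_mul, det_transpose, det_one] at this
    exact mul_self_eq_one_iff.mp this
  rcases hdet with hdet | hdet
  · have := hcocp.neg_one_le_trace (R := -O * reflection)
      (by
        rw [transpose_mul, transpose_neg, reflection_transpose, mul_assoc, ← mul_assoc reflection,
          reflection_mul_reflection, one_mul, neg_mul_neg, hO])
      (by rw [det_mul, det_neg, det_reflection, hdet]; norm_num)
    rw [transpose_mul, reflection_transpose, ← mul_assoc, trace_mul_comm, ← mul_assoc, ← mul_assoc,
      reflection_mul_reflection, one_mul, mul_neg, trace_neg] at this
    linarith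
  · have := hcp.neg_one_le_trace (R := -O) (by rw [transpose_neg, neg_mul_neg, hO])
      (by rw [det_neg, hdet]; norm_num)
    rw [mul_neg, trace_neg] at this
    linarith

theorem mem_traceBall_iff (Y : Matrix (Fin 3) (Fin 3) ℝ) :
    Y ∈ traceBall ↔
      IsCompletelyPositive (blochMap Y) ∧ IsCompletelyCopositive (blochMap Y) := by
  rw [IsCompletelyCopositive, blochMap_comp_transposition, traceBall, Set.mem_ofPred_eq]
  obtain ⟨U, V, t, hU, hV, ht, hnorm, rfl⟩ := exists_singularValue_factorization Y
  rw [hnorm]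
  constructor
  · intro h
    refine ⟨isCompletelyPositive_blochMap_of_factorization hU hV ht h, ?_⟩
    have hreflection : U * diagonal t * Vᵀ * reflection = U * diagonal t * (reflection * V)ᵀ := by
      rw [transpose_mul, reflection_transpose, mul_assoc]
    rw [hreflection]
    refine isCompletelyPositive_blochMap_of_factorization hU ?_ ht h
    rw [transpose_mul, reflection_transpose, mul_assoc, ← mul_assoc reflection,
      reflection_mul_reflection, one_mul, hV]
  · rintro ⟨hcp, hcocp⟩
    -- The orthogonal factor of the polar decomposition attains the trace norm.
    have h := trace_transpose_mul_le_one hcp hcocp (O := U * Vᵀ) (by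
      rw [transpose_mul, transpose_transpose, mul_assoc, ← mul_assoc Vᵀ, hV, one_mul,
        mul_eq_one_comm.mp hU])
    have htr : ((U * diagonal t * Vᵀ)ᵀ * (U * Vᵀ)).trace = ∑ i, t i := by
      simp only [transpose_mul, transpose_transpose, diagonal_transpose]
      rw [trace_mul_comm, mul_assoc, ← mul_assoc Vᵀ, hV, one_mul, trace_mul_comm, mul_assoc, hU,
        mul_one, trace_diagonal]
    rwa [htr] at h

/-! ### The homeomorphism -/

theorem IsBistochastic.spatialBlock_mem_operatorBall {S : M (Fin 2) →ₗ[ℂ] M (Fin 2)}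
    (hS : IsBistochastic S) : spatialBlock (piMatrix S) ∈ operatorBall := by
  rw [← isBistochastic_blochMap_iff, ← hS.eq_blochMap]
  exact hS

theorem continuous_spatialBlock_piMatrix :
    Continuous fun S : M (Fin 2) →L[ℂ] M (Fin 2) =>
      spatialBlock (piMatrix (S : M (Fin 2) →ₗ[ℂ] M (Fin 2))) := by
  refine continuous_matrix fun i j => ?_
  simp only [piMatrix_succ_succ, ContinuousLinearMap.coe_coe]
  fun_prop

theorem continuous_blochMap :
    Continuous fun Y : Matrix (Fin 3) (Fin 3) ℝ => (blochMap Y).toContinuousLinearMap := by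
  let e (i j : Fin 3) : M (Fin 2) →ₗ[ℂ] M (Fin 2) :=
    ((1 / 2 : ℂ) • (traceLinearMap (Fin 2) ℂ ℂ ∘ₗ LinearMap.mulLeft ℂ (spin j))).smulRight (spin i)
  have h (Y : Matrix (Fin 3) (Fin 3) ℝ) : (blochMap Y).toContinuousLinearMap =
      (blochMap 0).toContinuousLinearMap +
        ∑ i, ∑ j, (Y i j : ℂ) • (e i j).toContinuousLinearMap := by
    ext1 X
    have he (i j : Fin 3) : e i j X = ((1 / 2 : ℂ) * (spin j * X).trace) • spin i := rfl
    simp only [LinearMap.coe_toContinuousLinearMap', _root_.add_apply, _root_.sum_apply,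
      _root_.smul_apply, he, blochMap_apply, smul_add, Finset.smul_sum, smul_smul]
    simp only [Matrix.zero_apply, Complex.ofReal_zero, zero_mul, mul_zero, zero_smul,
      Finset.sum_const_zero, add_zero, mul_left_comm _ (1 / 2 : ℂ)]
  rw [funext h]
  fun_prop

/-- Passing to the action on Bloch vectors, with inverse `blochMap`. -/
noncomputable def blochHomeomorph : bistochasticMaps ≃ₜ operatorBall where
  toFun S := ⟨spatialBlock (piMatrix (S.1 : M (Fin 2) →ₗ[ℂ] M (Fin 2))),
    IsBistochastic.spatialBlock_mem_operatorBall S.2⟩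
  invFun Y := ⟨(blochMap Y.1).toContinuousLinearMap, (isBistochastic_blochMap_iff Y.1).2 Y.2⟩
  left_inv S := by
    ext1
    apply ContinuousLinearMap.coe_injective
    exact (IsBistochastic.eq_blochMap S.2).symm
  right_inv Y := Subtype.ext (spatialBlock_piMatrix_blochMap Y.1)
  continuous_toFun :=
    (continuous_spatialBlock_piMatrix.comp continuous_subtype_val).subtype_mk _
  continuous_invFun := (continuous_blochMap.comp continuous_subtype_val).subtype_mk _

theorem convexCombination_mem_bistochasticMaps {S T : M (Fin 2) →L[ℂ] M (Fin 2)}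
    (hS : S ∈ bistochasticMaps) (hT : T ∈ bistochasticMaps) {a b : ℝ} (ha : 0 ≤ a) (hb : 0 ≤ b)
    (hab : a + b = 1) : a • S + b • T ∈ bistochasticMaps := by
  obtain ⟨hS1, hS2, hS3⟩ := hS
  obtain ⟨hT1, hT2, hT3⟩ := hT
  refine ⟨fun A hA => ((hS1 A hA).smul ha).add ((hT1 A hA).smul hb), ?_, fun X => ?_⟩
  · change a • S 1 + b • T 1 = 1
    rw [show S 1 = 1 from hS2, show T 1 = 1 from hT2, ← add_smul, hab, one_smul]
  · change (a • S X + b • T X).trace = X.trace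
    rw [trace_add, trace_smul, trace_smul, show (S X).trace = _ from hS3 X,
      show (T X).trace = _ from hT3 X, ← add_smul, hab, one_smul]

theorem spatialBlock_piMatrix_add_smul (S T : M (Fin 2) →L[ℂ] M (Fin 2)) (a b : ℝ) :
    spatialBlock (piMatrix ((a • S + b • T : M (Fin 2) →L[ℂ] M (Fin 2)) :
        M (Fin 2) →ₗ[ℂ] M (Fin 2))) =
      a • spatialBlock (piMatrix (S : M (Fin 2) →ₗ[ℂ] M (Fin 2))) +
        b • spatialBlock (piMatrix (T : M (Fin 2) →ₗ[ℂ] M (Fin 2))) := by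
  ext i j
  rw [piMatrix_succ_succ, Matrix.add_apply, Matrix.smul_apply, Matrix.smul_apply,
    piMatrix_succ_succ, piMatrix_succ_succ]
  change (spin i * (a • S (spin j) + b • T (spin j))).trace.re / 2 = _
  simp only [mul_add, Matrix.mul_smul, trace_add, trace_smul, Complex.add_re, Complex.smul_re,
    smul_eq_mul, ContinuousLinearMap.coe_coe]
  ring

end QubitMaps

theorem theorem4 :
    ∃ F : QubitMaps.bistochasticMaps ≃ₜ QubitMaps.operatorBall,
      (∀ S : QubitMaps.bistochasticMaps,
        (F S : Matrix (Fin 3) (Fin 3) ℝ) =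
          QubitMaps.spatialBlock (QubitMaps.piMatrix
            (S.1 : QubitMaps.M (Fin 2) →ₗ[ℂ] QubitMaps.M (Fin 2)))) ∧
      (∀ (S T : QubitMaps.bistochasticMaps) (a b : ℝ), 0 ≤ a → 0 ≤ b → a + b = 1 →
        ∃ h : a • S.1 + b • T.1 ∈ QubitMaps.bistochasticMaps,
          (F ⟨a • S.1 + b • T.1, h⟩ : Matrix (Fin 3) (Fin 3) ℝ) =
            a • (F S : Matrix (Fin 3) (Fin 3) ℝ) + b • (F T : Matrix (Fin 3) (Fin 3) ℝ)) ∧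
      (fun S : QubitMaps.bistochasticMaps => (F S : Matrix (Fin 3) (Fin 3) ℝ)) ''
          {S | S.1 ∈ QubitMaps.bistochasticCPCoCP} = QubitMaps.traceBall := by
  refine ⟨QubitMaps.blochHomeomorph, fun S => rfl, fun S T a b ha hb hab =>
    ⟨QubitMaps.convexCombination_mem_bistochasticMaps S.2 T.2 ha hb hab,
      QubitMaps.spatialBlock_piMatrix_add_smul S.1 T.1 a b⟩, ?_⟩
  ext Y
  rw [QubitMaps.mem_traceBall_iff]
  constructor
  · rintro ⟨S, ⟨-, hS⟩, rfl⟩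
    rwa [QubitMaps.IsBistochastic.eq_blochMap S.2] at hS
  · intro h
    have hY : Y ∈ QubitMaps.operatorBall := by
      rw [QubitMaps.mem_operatorBall_iff, ← QubitMaps.isPositive_blochMap_iff]
      exact (h.1 0).1
    exact ⟨QubitMaps.blochHomeomorph.symm ⟨Y, hY⟩, ⟨Subtype.property _, h⟩,
      QubitMaps.spatialBlock_piMatrix_blochMap Y⟩
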